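/- Let $\mathbb{F}_q \subseteq \mathbb{F}_{q^r}$ be finite fields, $\sigma(x) = x^q$, $\boldsymbol\beta = (\beta_1,\dots,\beta_r)$ an ordered basis of $\mathbb{F}_{q^r}$ over $\mathbb{F}_q$, $\gamma$ a primitive element of $\mathbb{F}_{q^r}$, $g < q$ and $N = gr$. For $a, x \in \mathbb{F}_{q^r}$ put $\mathcal{D}_a^i(x) = \sigma^i(x)\,\sigma^{i-1}(a)\cdots\sigma(a)a$, and let $\mathcal{C}_{N,d} \subseteq \mathbb{F}_{q^r}^N = (\mathbb{F}_{q^r}^r)^g$ be the linearized Reed–Solomon code of all vectors $\big(\sum_{i<d} f_i \mathcal{D}_{\gamma^{j-1}}^i(\beta_\kappa)\big)_{1\le j\le g,\ 1\le\kappa\le r}$ with $f_0,\dots,f_{d-1} \in \mathbb{F}_{q^r}$. Let $M : \mathbb{F}_{q^r}^r \to \mathbb{F}_q^{r\times r}$ be the bijection that sends $\mathbf{x}$ to the matrix whose $j$-th column consists of the coordinates of $x_j$ in the basis $\boldsymbol\beta$. Put $\mathbf{x}\star\mathbf{y} = M^{-1}(M(\mathbf{x})M(\mathbf{y}))$, and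 define the inner matrix product of two vectors of blocks in $\mathbb{F}_{q^r}^r$ by $\mathbf{x}\cdot\mathbf{y} = \sum_p \mathbf{x}_p\star\mathbf{y}_p$. **Storage.** Let $k, t, \delta \ge 1$ and $k + rt \le N$, and put $c = N-k-rt+1$. Let $G_{out}$ be a generator matrix of $\mathcal{C}_{N,k}$, and let $A \in \mathbb{F}_q^{r\times(r+\delta-1)}$ be a generator matrix of an MDS code whose first $r$ columns form the identity matrix. Files $\mathbf{x}^1,\dots,\mathbf{x}^m \in \mathbb{F}_{q^r}^{b\times k}$ are encoded as $\mathbf{y}^\ell = \mathbf{x}^\ell G_{out}\,\mathrm{diag}(A,\dots,A)$. Server $j \in \{1,\dots,g\}$ stores the $j$-th group of $r+\delta-1$ columns of every $\mathbf{y}^\ell$, and $\mathbf{z}_j = (\mathbf{z}_j^{\ell,v})_{\ell\le m,\,v\le b} \in (\mathbb{F}_{q^r}^r)^{mb}$ denotes the first $r$ of these columns, row by row. **Scheme.** Let either $b = 1$ and $k = sc$ (first scheme), or $b = \mathrm{lcm}(c,k)/k$ and $s = \mathrm{lcm}(c,k)/c$ (folded, second scheme). Put $h = k/s$ and $J_u^v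 = h(v-1)+h(u-1)+\{1,\dots,h\}$. To retrieve file $i$, in each iteration $u = 1,\dots,s$ the user draws codewords $\mathbf{d}^{\ell,v}(u)$ ($\ell\le m$, $v\le b$) uniformly from $\mathcal{C}_{N,rt}$, all independent. The user sends to server $j$ the query $\mathbf{q}_j^i(u) = (\mathbf{d}_j^{\ell,v}(u) + \mathbf{e}_j^{\ell,v})_{\ell,v}$, where $\mathbf{e}_j^{\ell,v} = 0$ for $\ell\ne i$, and $\mathbf{e}_j^{i,v} = M^{-1}(I)$ with $I$ the diagonal $0/1$ matrix whose $\kappa$-th diagonal entry is $1$ exactly if $(j-1)r+\kappa \in J_u^v$. Server $j$ answers $\mathbf{z}_j\cdot\mathbf{q}_j^i(u) \in \mathbb{F}_{q^r}^r$. The $g$ answers of iteration $u$ form the total response $\mathbf{r}(u) \in \mathbb{F}_{q^r}^N$. With a parity-check matrix $H \in \mathbb{F}_{q^r}^{c\times N}$ of $\mathcal{C}_{N,k+rt-1}$, the user finds $\mathbf{w}(u)$ supported in $J_u^1\cup\dots\cup J_u^b$ with $\mathbf{w}(u)H^T = \mathbf{r}(u)H^T$ for every $u$, and then outputs the file $\mathbf{x}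 \in \mathbb{F}_{q^r}^{b\times k}$ such that, for all $v$ and $u$, the $v$-th row of $\mathbf{x}G_{out}$ agrees with $\mathbf{w}(u)$ in $J_u^v$. **Claim.** A parity-check matrix $H$ as above exists, and for every such $H$: 1. the scheme outputs $\mathbf{x}^i$, for all files, all $i$ and all random choices; 2. its download rate is $\dfrac{bk}{Ns} = \dfrac{N-k-rt+1}{N}$; 3. it is information-theoretically private against any $t$ colluding servers: for every $T \subseteq \{1,\dots,g\}$ with $|T| = t$ and every law of the index $i$, independent of the random choices, $I\big((\mathbf{q}_j^i(u))_{j\in T};\, i\big) = 0$ in each iteration $u$, and also $I\big((\mathbf{q}_j^i(u))_{j\in T,\,1\le u\le s};\, i\big) = 0$ for all iterations together. -/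

import Mathlib

open scoped Matrix Kronecker

noncomputable section

namespace LRSPIR

universe u

/-! ### Codes -/

/-- The rows of `G` form a basis of the linear code `C`. -/
def IsGeneratorMatrix {K ι : Type*} [Field K] {k : ℕ}
    (G : Matrix (Fin k) ι K) (C : Submodule K (ι → K)) : Prop :=
  LinearIndependent K G.row ∧ Submodule.span K (Set.range G.row) = C

/-- The rows of `H` form a basis of the dual code of `C`: they are linearly independent, and `C` is
the set of vectors `x` with `H xᵀ = 0`. -/
def IsParityCheckMatrix {K ι : Type*} [Field K] [Fintype ι] {c : ℕ}
    (H : Matrix (Fin c) ι K) (C : Submodule K (ι → K)) : Prop :=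
  LinearIndependent K H.row ∧ ∀ x : ι → K, x ∈ C ↔ H *ᵥ x = 0

open scoped Classical in
/-- `C` is a linear `(n, d)` MDS code, `n = |ι|`: its dimension is `d`, and its non-zero codewords
have Hamming weight at least `n - d + 1`. -/
def IsMDS {K ι : Type*} [Field K] [Fintype ι] (C : Submodule K (ι → K)) (d : ℕ) : Prop :=
  Module.finrank K C = d ∧ ∀ x ∈ C, x ≠ 0 → Fintype.card ι + 1 ≤ hammingNorm x + d

/-! ### Linearized Reed-Solomon codes

`F` is the field with `q` elements, `K` the extension of degree `r`. The `N = g r` coordinates are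
indexed by pairs `(j, κ) : Fin g × Fin r`, block `j` being the `j`-th local group. -/

/-- The operator `𝒟_a^i (x) = σ^i(x) N_i(a)`, where `σ(x) = x ^ q` and
`N_i(a) = σ^{i-1}(a) ⋯ σ(a) a`. -/
def linOp (F : Type*) {K : Type*} [Field F] [Fintype F] [Field K] (a : K) (i : ℕ) (x : K) : K :=
  x ^ (Fintype.card F ^ i) * ∏ l ∈ Finset.range i, a ^ (Fintype.card F ^ l)

section LRS

variable {F K : Type*} [Field F] [Fintype F] [Field K] [Algebra F K] {r : ℕ}

/-- The total evaluation vector of the skew polynomial `∑_{i < k} f_i x^i` at `(𝐚, β)` with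
`𝐚 = (γ^0, γ^1, …, γ^{g-1})`: its coordinate `(j, κ)` is `∑_{i < k} f_i 𝒟_{γ^j}^i (β_κ)`. A skew
polynomial of degree less than `k` (or zero) is given by its vector of coefficients. -/
def lrsEval (β : Module.Basis (Fin r) F K) (γ : K) (g k : ℕ) :
    (Fin k → K) →ₗ[K] (Fin g × Fin r → K) where
  toFun f := fun p => ∑ i : Fin k, f i * linOp F (γ ^ (p.1 : ℕ)) i (β p.2)
  map_add' f f' := by
    funext p
    simp [add_mul, Finset.sum_add_distrib]
  map_smul' a f := by
    funext p
    simp [Finset.mul_sum, mul_assoc]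

/-- The linearized Reed-Solomon code `𝒞_{N,k}(𝐚, β)`, `N = g r`. -/
def lrsCode (β : Module.Basis (Fin r) F K) (γ : K) (g k : ℕ) :
    Submodule K (Fin g × Fin r → K) :=
  LinearMap.range (lrsEval β γ g k)

end LRS

/-! ### Matrix products -/

section Products

variable {F K : Type*} [Field F] [Field K] [Algebra F K] {r : ℕ}

/-- The matrix representation map `M_β : K^r → F^{r × r}`: column `j` of `M_β(x)` consists of the
coordinates of `x_j` in the basis `β`. -/
def matRep (β : Module.Basis (Fin r) F K) : (Fin r → K) ≃ₗ[F] Matrix (Fin r) (Fin r) F where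
  toFun x := Matrix.of fun i j => β.repr (x j) i
  invFun A := fun j => ∑ i, A i j • β i
  map_add' x y := by
    ext i j
    simp
  map_smul' a x := by
    ext i j
    simp
  left_inv x := by
    funext j
    simp [β.sum_repr]
  right_inv A := by
    ext i j
    simp [Finsupp.single_apply]

/-- The matrix product `x ⋆ y = M_β⁻¹(M_β(x) M_β(y))` on `K^r`. -/
def matProd (β : Module.Basis (Fin r) F K) (x y : Fin r → K) : Fin r → K :=
  (matRep β).symm (matRep β x * matRep β y)

/-- The inner matrix product `x · y = ∑_p x_p ⋆ y_p` of two vectors of blocks of `K^r`. -/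
def innerMatProd (β : Module.Basis (Fin r) F K) {ι : Type*} [Fintype ι] (x y : ι → Fin r → K) :
    Fin r → K :=
  ∑ p, matProd β (x p) (y p)

end Products

/-! ### The storage system -/

section Storage

variable {F K : Type*} [Field F] [Field K] [Algebra F K] {g r δ k m b : ℕ}

/-- The generator matrix `G_out diag(A, …, A)` of the global code. The `r + δ - 1` coordinates of
a local group are `Fin (r + (δ - 1))`, the first `r` of them being the non-redundant ones. -/
def globalGen (G : Matrix (Fin k) (Fin g × Fin r) K) (A : Matrix (Fin r) (Fin (r + (δ - 1))) F) :
    Matrix (Fin k) (Fin g × Fin (r + (δ - 1))) K :=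
  G * ((1 : Matrix (Fin g) (Fin g) K) ⊗ₖ A.map (algebraMap F K))

/-- The content of server `j`, that is, of the `j`-th local group: the `r + δ - 1` coordinates of
that group in each of the `b` rows of each encoded file `y^ℓ = x^ℓ G_glob`. -/
def stored (Gglob : Matrix (Fin k) (Fin g × Fin (r + (δ - 1))) K)
    (X : Fin m → Matrix (Fin b) (Fin k) K) (j : Fin g) :
    Fin m × Fin b → Fin (r + (δ - 1)) → K :=
  fun p ν => (X p.1 * Gglob) p.2 (j, ν)

/-- The part `z_j` of the content of a server that is left after the local redundancies are
disregarded: the first `r` coordinates of the local group. -/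
def nonRedundant (y : Fin m × Fin b → Fin (r + (δ - 1)) → K) : Fin m × Fin b → Fin r → K :=
  fun p κ => y p (Fin.castAdd (δ - 1) κ)

end Storage

/-! ### Private information retrieval -/

/-- The mutual information (in nats)
`I(X; Y) = ∑_{x, y} p(x, y) log (p(x, y) / (p(x) p(y)))` of two random variables with finitely many
values on a discrete probability space. -/
def mutualInfo {Ω α α' : Type*} [Fintype α] [Fintype α'] (P : PMF Ω) (X : Ω → α) (Y : Ω → α') : ℝ :=
  ∑ x, ∑ y, ((P.map fun ω => (X ω, Y ω)) (x, y)).toReal *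
    Real.log (((P.map fun ω => (X ω, Y ω)) (x, y)).toReal /
      (((P.map X) x).toReal * ((P.map Y) y).toReal))

/-- The law of a pair of independent random variables with laws `π` and `P`. -/
def prodLaw {α Ω : Type*} (π : PMF α) (P : PMF Ω) : PMF (α × Ω) :=
  π.bind fun a => P.map fun ω => (a, ω)

/-- A retrieval scheme for `m` files in `K^{b × k}` stored in `g` servers, each server holding
`b m` blocks of `K^r`: a number of iterations, the (discrete) random choices of the user and their
law, the query that is sent to each server in each iteration, given the index of the wanted file and
the random choices, and the reconstruction of the file from the total responses. -/
structure PIRScheme (K : Type u) (m g r b k : ℕ) where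
  /-- number of iterations -/
  iterations : ℕ
  /-- random choices of the user -/
  Rand : Type u
  /-- their law -/
  law : PMF Rand
  /-- the query `q_j^i(u)` -/
  query : (i : Fin m) → (u : Fin iterations) → Rand → (j : Fin g) → Fin m × Fin b → Fin r → K
  /-- the `i`-th file as a function of the total responses of all iterations -/
  reconstruct : (i : Fin m) → (Fin iterations → Fin g × Fin r → K) → Matrix (Fin b) (Fin k) K

namespace PIRScheme

variable {F : Type*} {K : Type u} [Field F] [Field K] [Algebra F K] {m g r b k : ℕ}

/-- The total response `(r_1^i, …, r_g^i)` in each iteration, where `r_j^i = z_j · q_j^i` is the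
response of server `j`, computed from its data `z_j` and its query only. -/
def responses (S : PIRScheme K m g r b k) (β : Module.Basis (Fin r) F K)
    (z : Fin g → Fin m × Fin b → Fin r → K) (i : Fin m) (ω : S.Rand) :
    Fin S.iterations → Fin g × Fin r → K :=
  fun u p => innerMatProd β (z p.1) (S.query i u ω p.1) p.2

/-- The scheme retrieves every file, whatever the stored files are and whatever the random choices
are, from the storage system with generator matrix `Gglob`. -/
def RetrievesFrom {δ : ℕ} (S : PIRScheme K m g r b k) (β : Module.Basis (Fin r) F K)
    (Gglob : Matrix (Fin k) (Fin g × Fin (r + (δ - 1))) K) : Prop :=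
  ∀ (X : Fin m → Matrix (Fin b) (Fin k) K) (i : Fin m) (ω : S.Rand),
    S.reconstruct i (S.responses β (fun j => nonRedundant (stored Gglob X j)) i ω) = X i

/-- The download rate `b k / (N s)`, `N = g r`: the file size divided by the amount of downloaded
data. -/
def rate (S : PIRScheme K m g r b k) : ℚ :=
  ((b * k : ℕ) : ℚ) / ((g * r * S.iterations : ℕ) : ℚ)

/-- The scheme protects against `t` colluding servers: for every set `T` of `t` servers, in each
iteration, the mutual information of `(q_j^i)_{j ∈ T}` and the file index `i` is zero, for every
law of the index `i` (which is independent of the random choices of the scheme). -/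
def ProtectsAgainst [Fintype K] (S : PIRScheme K m g r b k) (t : ℕ) : Prop :=
  ∀ T : Finset (Fin g), T.card = t → ∀ (u : Fin S.iterations) (π : PMF (Fin m)),
    mutualInfo (prodLaw π S.law)
      (fun x => fun j : {j // j ∈ T} => S.query x.1 u x.2 j.1) (fun x => x.1) = 0

/-- The same for the queries of all iterations together. -/
def ProtectsJointlyAgainst [Fintype K] (S : PIRScheme K m g r b k) (t : ℕ) : Prop :=
  ∀ T : Finset (Fin g), T.card = t → ∀ π : PMF (Fin m),
    mutualInfo (prodLaw π S.law)
      (fun x => fun (u : Fin S.iterations) (j : {j // j ∈ T}) => S.query x.1 u x.2 j.1)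
      (fun x => x.1) = 0

end PIRScheme

/-! ### The scheme -/

section Scheme

variable {F : Type*} {K : Type u} [Field F] [Field K] [Algebra F K] {g r k s b c : ℕ}

/-- The place of the coordinate `(j, κ)` among the `N = g r` coordinates, counted from `0`. -/
def place (p : Fin g × Fin r) : ℕ := (p.1 : ℕ) * r + (p.2 : ℕ)

/-- The set `J_u^v = h (v - 1) + h (u - 1) + {1, …, h}`, for `u`, `v` and the places all counted
from `0`, that is, `{h (u + v), …, h (u + v) + h - 1}`. -/
def window (h u v : ℕ) : Finset ℕ := Finset.Ico (h * (v + u)) (h * (v + u) + h)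

/-- Block `(i, v)` of `e_j^i(u)`: the vector `M_β⁻¹(I_J)`, where `I_J` is the diagonal matrix that
indicates the places of `J_u^v` in the `j`-th group. -/
def indicatorBlock (β : Module.Basis (Fin r) F K) (h u v : ℕ) (j : Fin g) : Fin r → K :=
  (matRep β).symm
    (Matrix.diagonal fun κ : Fin r => if place (j, κ) ∈ window h u v then (1 : F) else 0)

/-- How the file is computed from the responses `ρ(1), …, ρ(s)`: `w(u)` is the vector supported in
`J_u^1 ∪ … ∪ J_u^b` with `w(u) Hᵀ = ρ(u) Hᵀ`, and `x` is the file whose `v`-th encoded row, for each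
`v`, agrees with `w(u)` in `J_u^v` for all `u`. -/
def IsReconstruction (G : Matrix (Fin k) (Fin g × Fin r) K) (H : Matrix (Fin c) (Fin g × Fin r) K)
    (h : ℕ) (ρ : Fin s → Fin g × Fin r → K) (x : Matrix (Fin b) (Fin k) K) : Prop :=
  ∃ w : Fin s → Fin g × Fin r → K,
    (∀ (u : Fin s) p, (∀ v : Fin b, place p ∉ window h u v) → w u p = 0) ∧
    (∀ u, H *ᵥ w u = H *ᵥ ρ u) ∧
    ∀ (u : Fin s) (v : Fin b) p, place p ∈ window h u v → (x * G) v p = w u p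

/-- The scheme with folding parameter `b`, with `s` iterations and windows of size `h`, against `t`
colluding servers. Its random choices are codewords `d^{ℓ,v}(u)` that are independent and uniformly
distributed in `𝒞_{N,rt}(𝐚, β)`. The query `q_j^i(u) = d_j(u) + e_j^i(u)` adds to `d_j(u)` the blocks
`M_β⁻¹(I_J)` in the positions of the `i`-th file. -/
def lrsScheme [Fintype F] [Fintype K] (β : Module.Basis (Fin r) F K) (γ : K) (m t : ℕ)
    (b s h : ℕ) (G : Matrix (Fin k) (Fin g × Fin r) K) (H : Matrix (Fin c) (Fin g × Fin r) K) :
    PIRScheme K m g r b k where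
  iterations := s
  Rand := Fin s → Fin m × Fin b → lrsCode β γ g (r * t)
  law := @PMF.uniformOfFintype _ (Fintype.ofFinite _) _
  query i u d j p κ :=
    (d u p : Fin g × Fin r → K) (j, κ) + if p.1 = i then indicatorBlock β h u p.2 j κ else 0
  reconstruct _ ρ := Classical.epsilon fun x => IsReconstruction G H h ρ x

end Scheme

end LRSPIR

end

open LRSPIR

/-! Everything rests on a bound for zeros (`skewEval_coeff_eq_zero`): at nonzero points from
distinct conjugacy classes, the zero spaces of a nonzero skew polynomial with `d` coefficients have
total `F`-dimension less than `d`. Since `g < q`, the points `γ^j` qualify, so any `d` coordinates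
determine a codeword of dimension `d`.

Retrieval: a block of a codeword is, as a matrix, the `F`-linear map given by evaluating a skew
polynomial, and `⋆` is composition. Hence products of codewords of dimensions `k` and `rt` lie in
the code of dimension `k + rt - 1` (`matProd_mem_lrsCode`), which `H` annihilates. What survives of
a response is the wanted file read on `hb = c` consecutive places. A codeword supported there
vanishes on `N - c = k + rt - 1` places, hence is zero, so the syndrome determines these entries.
Over all iterations each row is seen on `hs = k` consecutive places, enough to determine it.

Privacy: the masking code, of dimension `rt`, takes all values on `t` blocks. A change of the file
index can therefore be undone on the colluding servers by translating the masks, and the uniform law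
is invariant under translation. -/

namespace LRSPIR

/-! ### Skew polynomials and their zeros -/

section SkewPolynomials

variable {F K : Type*} [Field F] [Fintype F] [Field K]

theorem linOp_zero (a x : K) : linOp F a 0 x = x := by
  simp [linOp]

theorem linOp_one (a x : K) : linOp F a 1 x = x ^ Fintype.card F * a := by
  simp [linOp]

/-- At a fixed point, evaluation turns the skew product `x^i · b x^l = σ^i(b) x^(i+l)` into
composition, because `N_{i+l}(a) = N_i(a) σ^i(N_l(a))`. -/
theorem linOp_mul_linOp (a b x : K) (i l : ℕ) :
    linOp F a i (b * linOp F a l x) = b ^ (Fintype.card F ^ i) * linOp F a (i + l) x := by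
  have h1 : ∀ y, a ^ (Fintype.card F ^ (i + y)) =
      (a ^ (Fintype.card F ^ y)) ^ (Fintype.card F ^ i) := by
    intro y
    rw [← pow_mul, pow_add, mul_comm]
  have h2 : x ^ (Fintype.card F ^ (i + l)) =
      (x ^ (Fintype.card F ^ l)) ^ (Fintype.card F ^ i) := by
    rw [← pow_mul, pow_add, mul_comm]
  simp only [linOp]
  rw [Finset.prod_range_add, mul_pow, mul_pow, ← Finset.prod_pow]
  simp only [h1, h2]
  ring

variable [Algebra F K]

variable (F) in
/-- `linOp` as a linear map over the field with `q` elements. -/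
noncomputable def linOpHom (a : K) (i : ℕ) : K →ₗ[F] K :=
  LinearMap.mulRight F (∏ l ∈ Finset.range i, a ^ (Fintype.card F ^ l)) ∘ₗ
    ((FiniteField.frobeniusAlgHom F K) ^ i).toLinearMap

theorem linOpHom_apply (a : K) (i : ℕ) (x : K) : linOpHom F a i x = linOp F a i x := by
  have : ∀ i : ℕ, ((FiniteField.frobeniusAlgHom F K) ^ i) x = x ^ (Fintype.card F ^ i) := by
    intro i
    induction i with
    | zero => simp
    | succ n ih =>
      rw [pow_succ', AlgHom.mul_apply, ih, FiniteField.coe_frobeniusAlgHom, pow_succ, pow_mul]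
  simp only [linOpHom, linOp, LinearMap.comp_apply, AlgHom.toLinearMap_apply, this,
    LinearMap.mulRight_apply]

variable (F) in
/-- The evaluation at `a` of the skew polynomial `∑_{i < d} f_i x^i`. -/
noncomputable def skewEval (d : ℕ) (f : ℕ → K) (a : K) : K →ₗ[F] K :=
  ∑ i ∈ Finset.range d, LinearMap.mulLeft F (f i) ∘ₗ linOpHom F a i

theorem skewEval_apply (d : ℕ) (f : ℕ → K) (a x : K) :
    skewEval F d f a x = ∑ i ∈ Finset.range d, f i * linOp F a i x := by
  simp [skewEval, linOpHom_apply]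

theorem linOp_sub (a x y : K) (i : ℕ) :
    linOp F a i (x - y) = linOp F a i x - linOp F a i y := by
  simp only [← linOpHom_apply, map_sub]

theorem linOp_linOp_one_sub (a c x : K) (i : ℕ) :
    linOp F a i (linOp F a 1 x - c * x) =
      linOp F a (i + 1) x - c ^ (Fintype.card F ^ i) * linOp F a i x := by
  have h1 := linOp_mul_linOp (F := F) a 1 x i 1
  have h2 := linOp_mul_linOp (F := F) a c x i 0
  simp only [one_mul, one_pow, linOp_zero, add_zero] at h1 h2
  rw [linOp_sub, h1, h2]

/-- Right division of a skew polynomial by `x - c`. -/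
theorem exists_skew_division (c : K) (d : ℕ) (f : ℕ → K) :
    ∃ (f' : ℕ → K) (ρ : K),
      (∀ a x, skewEval F (d + 1) f a x =
        skewEval F d f' a (linOp F a 1 x - c * x) + ρ * x) ∧
      ((∀ i < d, f' i = 0) → ∀ i < d, f (i + 1) = 0) := by
  induction d generalizing f with
  | zero =>
    refine ⟨0, f 0, fun a x => ?_, by simp⟩
    simp [skewEval_apply, linOp_zero]
  | succ d ih =>
    -- Splitting off `f_{d+1} x^d (x - c)` removes the leading term and leaves `f_{d+1} σ^d(c) x^d`,
    -- which is absorbed into coefficient `d`.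
    obtain ⟨f₁, ρ, h1, h2⟩ :=
      ih (Function.update f d (f d + f (d + 1) * c ^ (Fintype.card F ^ d)))
    refine ⟨Function.update f₁ d (f (d + 1)), ρ, fun a x => ?_, fun h i hi => ?_⟩
    · have hcongr : ∀ (g : ℕ → K) (z y : K),
          ∑ i ∈ Finset.range d, Function.update g d z i * linOp F a i y =
            ∑ i ∈ Finset.range d, g i * linOp F a i y := by
        intro g z y
        refine Finset.sum_congr rfl fun i hi => ?_
        rw [Function.update_of_ne (Finset.mem_range.1 hi).ne]
      have h := h1 a x
      simp only [skewEval_apply, Finset.sum_range_succ, Function.update_self, hcongr] at h ⊢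
      rw [linOp_linOp_one_sub a c x d]
      linear_combination h
    · have hd : f (d + 1) = 0 := by simpa using h d (by omega)
      rcases Nat.lt_succ_iff_lt_or_eq.1 hi with hi' | rfl
      · have := h2 (fun i hi => by
          simpa [Function.update_of_ne hi.ne] using h i (by omega)) i hi'
        by_cases hid : i + 1 = d
        · subst hid
          simpa [hd] using this
        · rwa [Function.update_of_ne hid] at this
      · exact hd

/-- The image of `F` already supplies `q` roots of `X^q - X`, and there are no more. -/
theorem exists_algebraMap_eq_of_pow_card_eq {y : K} (hy : y ^ Fintype.card F = y) :
    ∃ e : F, algebraMap F K e = y := by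
  classical
  have hne := FiniteField.X_pow_card_sub_X_ne_zero K (Fintype.one_lt_card (α := F))
  set P : Polynomial K := Polynomial.X ^ Fintype.card F - Polynomial.X with hP
  have hroot : ∀ z : K, z ∈ P.roots.toFinset ↔ z ^ Fintype.card F = z := by
    intro z
    rw [Multiset.mem_toFinset, Polynomial.mem_roots hne]
    simp [hP, sub_eq_zero]
  have hsub : Finset.univ.image (algebraMap F K) ⊆ P.roots.toFinset := by
    intro z hz
    obtain ⟨e, -, rfl⟩ := Finset.mem_image.1 hz
    rw [hroot, ← map_pow, FiniteField.pow_card]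
  have hcard : P.roots.toFinset.card ≤ (Finset.univ.image (algebraMap F K)).card := by
    rw [Finset.card_image_of_injective _ (algebraMap F K).injective, Finset.card_univ]
    refine (Multiset.toFinset_card_le _).trans ((Polynomial.card_roots' _).trans ?_)
    rw [hP, FiniteField.X_pow_card_sub_X_natDegree_eq K Fintype.one_lt_card]
  have := (Finset.eq_of_subset_of_card_le hsub hcard) ▸ (hroot y).2 hy
  simpa using this

/-- A skew polynomial with as many independent zeros as coefficients, at evaluation points in
distinct conjugacy classes, vanishes. -/
theorem skewEval_coeff_eq_zero [FiniteDimensional F K] {ι : Type*} [Fintype ι] (a : ι → K)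
    (ha : ∀ j, a j ≠ 0)
    (hconj : ∀ i j x y, x ≠ 0 → y ≠ 0 → linOp F (a i) 1 x * y = linOp F (a j) 1 y * x → i = j)
    (d : ℕ) (f : ℕ → K) (V : ι → Submodule F K)
    (hV : ∀ j, ∀ x ∈ V j, skewEval F d f (a j) x = 0)
    (hd : d ≤ ∑ j, Module.finrank F (V j)) : ∀ i < d, f i = 0 := by
  classical
  induction d generalizing f V with
  | zero => simp
  | succ d ih =>
    obtain ⟨j₀, -, hj₀⟩ : ∃ j ∈ Finset.univ, Module.finrank F (V j) ≠ 0 :=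
      Finset.exists_ne_zero_of_sum_ne_zero (by omega)
    have hbot : V j₀ ≠ ⊥ := fun h => hj₀ (by simp [h])
    obtain ⟨x₀, hx₀, hx₀'⟩ := Submodule.exists_mem_ne_zero_of_ne_bot hbot
    -- This conjugate of `a j₀` makes `x - c` kill `x₀`, so that division by `x - c` leaves no
    -- remainder.
    set c := linOp F (a j₀) 1 x₀ / x₀ with hc
    have hcx : linOp F (a j₀) 1 x₀ = c * x₀ := by rw [hc]; field_simp
    obtain ⟨f', ρ, h1, h2⟩ := exists_skew_division (F := F) c d f
    have hρ : ρ = 0 := by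
      have := h1 (a j₀) x₀
      rw [hV j₀ x₀ hx₀, hcx] at this
      simpa [hx₀'] using this.symm
    let T : ι → K →ₗ[F] K := fun j => linOpHom F (a j) 1 - LinearMap.mulLeft F c
    have hT : ∀ j x, T j x = linOp F (a j) 1 x - c * x := by
      intro j x
      simp [T, linOpHom_apply]
    -- Applying `x - c` loses at most one dimension in total: its kernel at `a j₀` is the `F`-line
    -- through `x₀`, and a nonzero kernel vector at another point would make that point conjugate to
    -- `a j₀`.
    have hdim : ∀ j, Module.finrank F (V j) ≤
        Module.finrank F ((V j).map (T j)) + if j = j₀ then 1 else 0 := by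
      intro j
      have hrk := LinearMap.finrank_range_add_finrank_ker ((T j).domRestrict (V j))
      rw [LinearMap.range_domRestrict] at hrk
      suffices Module.finrank F (LinearMap.ker ((T j).domRestrict (V j))) ≤
          if j = j₀ then 1 else 0 by omega
      split_ifs with hj
      · subst hj
        refine finrank_le_one ⟨⟨x₀, hx₀⟩, ?_⟩ ?_
        · simp [hT, hcx]
        · rintro ⟨⟨y, hy⟩, hy'⟩
          rw [LinearMap.mem_ker, LinearMap.domRestrict_apply, hT, sub_eq_zero] at hy'
          have hfix : (y / x₀) ^ Fintype.card F = y / x₀ := by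
            rw [linOp_one] at hy' hcx
            have := ha j
            rw [div_pow, div_eq_div_iff (pow_ne_zero _ hx₀') hx₀']
            have h3 : a j * (y ^ Fintype.card F * x₀) = a j * (y * x₀ ^ Fintype.card F) := by
              simp only at hy'
              linear_combination x₀ * hy' - y * hcx
            exact mul_left_cancel₀ this h3
          obtain ⟨e, he⟩ := exists_algebraMap_eq_of_pow_card_eq hfix
          refine ⟨e, ?_⟩
          ext
          simp [Algebra.smul_def, he, hx₀']
      · rw [Nat.le_zero, Submodule.finrank_eq_zero, eq_bot_iff]
        rintro ⟨y, hy⟩ hy'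
        rw [LinearMap.mem_ker, LinearMap.domRestrict_apply, hT, sub_eq_zero] at hy'
        rw [Submodule.mem_bot]
        by_contra hne
        have hy0 : y ≠ 0 := fun h => hne (by ext; exact h)
        refine hj (hconj j j₀ y x₀ hy0 hx₀' ?_)
        simp only at hy'
        rw [hy', hcx]
        ring
    have hf' : ∀ i < d, f' i = 0 := by
      refine ih f' (fun j => (V j).map (T j)) ?_ ?_
      · rintro j _ ⟨x, hx, rfl⟩
        have := h1 (a j) x
        rw [hV j x hx, hρ] at this
        rw [hT]
        simpa using this.symm
      · have := (hd.trans (Finset.sum_le_sum fun j _ => hdim j))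
        rw [Finset.sum_add_distrib, Finset.sum_ite_eq'] at this
        simpa using this
    have hf := h2 hf'
    intro i hi
    rcases i with _ | i
    · have := hV j₀ x₀ hx₀
      rw [skewEval_apply, Finset.sum_range_succ', Finset.sum_eq_zero] at this
      · simpa [linOp_zero, hx₀'] using this
      · intro i hi
        rw [hf i (Finset.mem_range.1 hi), zero_mul]
    · exact hf i (by omega)

end SkewPolynomials

/-! ### Linearized Reed–Solomon codes -/

section Codes

variable {F K : Type*} [Field F] [Fintype F] [Field K] [Algebra F K] {g r : ℕ}

theorem lrsEval_eq_skewEval (β : Module.Basis (Fin r) F K) (γ : K) {d : ℕ} (f : Fin d → K)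
    (p : Fin g × Fin r) :
    lrsEval β γ g d f p =
      skewEval F d (fun i => if h : i < d then f ⟨i, h⟩ else 0) (γ ^ (p.1 : ℕ)) (β p.2) := by
  rw [skewEval_apply, Finset.sum_range]
  simp [lrsEval]

/-- The powers `γ^0, …, γ^{q-2}` of a primitive element lie in distinct conjugacy classes. -/
theorem eq_of_linOp_one_mul_eq [Fintype K] {γ : Kˣ} (hγ : ∀ x : Kˣ, x ∈ Subgroup.zpowers γ)
    {i j : ℕ} (hi : i + 1 < Fintype.card F) (hj : j + 1 < Fintype.card F) {x y : K} (hx : x ≠ 0)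
    (hy : y ≠ 0)
    (h : linOp F ((γ : K) ^ i) 1 x * y = linOp F ((γ : K) ^ j) 1 y * x) : i = j := by
  obtain ⟨Q, hQ⟩ : ∃ Q, Fintype.card F = Q + 1 := ⟨Fintype.card F - 1, by omega⟩
  obtain ⟨n, hn⟩ := Subgroup.mem_zpowers_iff.1 (hγ (Units.mk0 y hy / Units.mk0 x hx))
  -- Conjugates differ by a `(q-1)`-th power, and `Q = q - 1` divides the order of `γ`. So `Q`
  -- divides `i - j`, whose absolute value is less than `Q`.
  have h1 : γ ^ i = γ ^ j * (Units.mk0 y hy / Units.mk0 x hx) ^ Q := by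
    ext
    simp only [Units.val_mul, Units.val_pow_eq_pow_val, Units.val_div_eq_div_val, Units.val_mk0]
    rw [linOp_one, linOp_one, hQ] at h
    rw [div_pow, mul_div_assoc', eq_div_iff (pow_ne_zero _ hx)]
    have : x * y * ((γ : K) ^ i * x ^ Q) = x * y * ((γ : K) ^ j * y ^ Q) := by
      linear_combination h
    exact mul_left_cancel₀ (mul_ne_zero hx hy) this
  have h2 : γ ^ ((i : ℤ) - j - n * Q) = 1 := by
    rw [zpow_sub, zpow_sub, zpow_mul, hn, zpow_natCast, zpow_natCast, zpow_natCast, h1]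
    simp
  have hord : (Q : ℤ) ∣ orderOf γ := by
    rw [orderOf_eq_card_of_forall_mem_zpowers hγ, Nat.card_units, Nat.card_eq_fintype_card,
      Module.card_eq_pow_finrank (K := F) (V := K), hQ]
    have := Nat.sub_dvd_pow_sub_pow (Q + 1) 1 (Module.finrank F K)
    simp only [Nat.add_sub_cancel, one_pow] at this
    exact_mod_cast this
  have h3 : (Q : ℤ) ∣ (i : ℤ) - j := by
    have := hord.trans (orderOf_dvd_iff_zpow_eq_one.2 h2)
    have h4 := dvd_add this (Dvd.intro_left n rfl)
    simpa using h4
  have h4 : (i : ℤ) - j = 0 := by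
    refine Int.eq_zero_of_abs_lt_dvd h3 ?_
    rw [abs_lt]
    omega
  omega

/-- A polynomial of degree less than `d` is determined by `d` coordinates of its codeword. -/
theorem eq_zero_of_lrsEval_eq_zero [Fintype K] (hq : g < Fintype.card F)
    (β : Module.Basis (Fin r) F K) {γ : Kˣ} (hγ : ∀ x : Kˣ, x ∈ Subgroup.zpowers γ) {d : ℕ}
    {f : Fin d → K} {Z : Finset (Fin g × Fin r)} (hZ : d ≤ Z.card)
    (h : ∀ p ∈ Z, lrsEval β (γ : K) g d f p = 0) : f = 0 := by
  classical
  -- By `F`-linearity, vanishing at basis elements extends to their span, and the dimensions of the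
  -- spans add up to `|Z|`.
  let V : Fin g → Submodule F K := fun j =>
    Submodule.span F (β '' {κ | (j, κ) ∈ Z})
  have hV : ∀ j, Module.finrank F (V j) = (Finset.univ.filter fun κ => (j, κ) ∈ Z).card := by
    intro j
    have := finrank_span_set_eq_card (s := β '' {κ | (j, κ) ∈ Z})
      (β.linearIndependent.linearIndepOn_id.mono (Set.image_subset_range _ _))
    rw [this, Set.toFinset_image, Finset.card_image_of_injective _ β.injective]
    congr 1
    ext
    simp
  have hcard : ∑ j, Module.finrank F (V j) = Z.card := by
    simp only [hV, Finset.card_filter]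
    rw [← Fintype.sum_prod_type' (fun j κ => if (j, κ) ∈ Z then 1 else 0)]
    simp
  have := skewEval_coeff_eq_zero (F := F) (fun j : Fin g => (γ : K) ^ (j : ℕ))
    (fun j => pow_ne_zero _ γ.ne_zero)
    (fun i j x y hx hy hxy => Fin.ext
      (eq_of_linOp_one_mul_eq hγ (by omega) (by omega) hx hy hxy)) d
    (fun i => if h : i < d then f ⟨i, h⟩ else 0) V
    (fun j x hx => ?_) (by rw [hcard]; exact hZ)
  · ext i
    simpa using this i i.2
  · induction hx using Submodule.span_induction with
    | mem x hx =>
      obtain ⟨κ, hκ, rfl⟩ := hx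
      exact (lrsEval_eq_skewEval β _ f (j, κ)).symm.trans (h (j, κ) hκ)
    | zero => simp
    | add x y _ _ hx hy => rw [map_add, hx, hy, add_zero]
    | smul a x _ hx => rw [map_smul, hx, smul_zero]

theorem eq_zero_of_mem_lrsCode [Fintype K] (hq : g < Fintype.card F)
    (β : Module.Basis (Fin r) F K) {γ : Kˣ} (hγ : ∀ x : Kˣ, x ∈ Subgroup.zpowers γ) {d : ℕ}
    {x : Fin g × Fin r → K} (hx : x ∈ lrsCode β (γ : K) g d) {Z : Finset (Fin g × Fin r)}
    (hZ : d ≤ Z.card) (h : ∀ p ∈ Z, x p = 0) : x = 0 := by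
  obtain ⟨f, rfl⟩ := hx
  rw [eq_zero_of_lrsEval_eq_zero hq β hγ hZ h, map_zero]

theorem finrank_lrsCode [Fintype K] (hq : g < Fintype.card F)
    (β : Module.Basis (Fin r) F K) {γ : Kˣ} (hγ : ∀ x : Kˣ, x ∈ Subgroup.zpowers γ) {d : ℕ}
    (hd : d ≤ g * r) : Module.finrank K (lrsCode β (γ : K) g d) = d := by
  rw [lrsCode, LinearMap.finrank_range_of_inj, Module.finrank_fin_fun]
  rw [← LinearMap.ker_eq_bot, LinearMap.ker_eq_bot']
  intro f hf
  exact eq_zero_of_lrsEval_eq_zero hq β hγ (Z := Finset.univ) (by simpa using hd)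
    (fun p _ => congrFun hf p)

/-- The codewords take all values in `t` blocks of coordinates when the dimension is `r t`. -/
theorem exists_mem_lrsCode_eq_on [Fintype K] (hq : g < Fintype.card F)
    (β : Module.Basis (Fin r) F K) {γ : Kˣ} (hγ : ∀ x : Kˣ, x ∈ Subgroup.zpowers γ)
    (T : Finset (Fin g)) (y : Fin g × Fin r → K) :
    ∃ x ∈ lrsCode β (γ : K) g (r * T.card), ∀ j ∈ T, ∀ κ, x (j, κ) = y (j, κ) := by
  let L : (Fin (r * T.card) → K) →ₗ[K] (T × Fin r → K) :=
    LinearMap.funLeft K K (fun p : T × Fin r => ((p.1 : Fin g), p.2)) ∘ₗ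
      lrsEval β (γ : K) g (r * T.card)
  have hL : Function.Injective L := by
    rw [← LinearMap.ker_eq_bot, LinearMap.ker_eq_bot']
    intro f hf
    refine eq_zero_of_lrsEval_eq_zero hq β hγ (Z := T ×ˢ Finset.univ) ?_ ?_
    · simp [mul_comm]
    · rintro ⟨j, κ⟩ hp
      exact congrFun hf (⟨j, (Finset.mem_product.1 hp).1⟩, κ)
  have hL' : Function.Surjective L := by
    refine (LinearMap.injective_iff_surjective_of_finrank_eq_finrank ?_).1 hL
    simp [mul_comm]
  obtain ⟨f, hf⟩ := hL' fun p => y (p.1, p.2)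
  exact ⟨lrsEval β (γ : K) g _ f, ⟨f, rfl⟩, fun j hj κ => congrFun hf (⟨j, hj⟩, κ)⟩

/-- The matrix of the quotient map by `C` serves; its rows are independent because the map is
surjective. -/
theorem exists_isParityCheckMatrix {K ι : Type*} [Field K] [Fintype ι] {c : ℕ}
    (C : Submodule K (ι → K)) (hC : Module.finrank K C + c = Fintype.card ι) :
    ∃ H : Matrix (Fin c) ι K, IsParityCheckMatrix H C := by
  classical
  have hfin : Module.finrank K ((ι → K) ⧸ C) = Module.finrank K (Fin c → K) := by
    have := C.finrank_quotient_add_finrank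
    simp only [Module.finrank_fintype_fun_eq_card, Fintype.card_fin] at this ⊢
    omega
  let e := LinearEquiv.ofFinrankEq _ _ hfin
  let φ : (ι → K) →ₗ[K] (Fin c → K) := e.toLinearMap ∘ₗ C.mkQ
  have hφ : Function.Surjective φ := e.surjective.comp C.mkQ_surjective
  refine ⟨LinearMap.toMatrix' φ, ?_, fun x => ?_⟩
  · rw [← Matrix.vecMul_injective_iff]
    intro v w hvw
    refine dotProduct_eq v w fun u => ?_
    obtain ⟨x, rfl⟩ := hφ u
    have := congrArg (· ⬝ᵥ x) hvw
    simpa only [← Matrix.dotProduct_mulVec, LinearMap.toMatrix'_mulVec] using this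
  · rw [LinearMap.toMatrix'_mulVec]
    simp [φ]

theorem linOp_mem_lrsCode (β : Module.Basis (Fin r) F K) (γ a : K) {d n : ℕ} (hn : n < d) :
    (fun p : Fin g × Fin r => a * linOp F (γ ^ (p.1 : ℕ)) n (β p.2)) ∈ lrsCode β γ g d := by
  refine ⟨Pi.single ⟨n, hn⟩ a, ?_⟩
  ext p
  simp [lrsEval, Pi.single_apply]

end Codes

/-! ### The matrix product of codewords -/

section Products

variable {F K : Type*} [Field F] [Field K] [Algebra F K] {r : ℕ}

theorem matProd_add (β : Module.Basis (Fin r) F K) (x y y' : Fin r → K) :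
    matProd β x (y + y') = matProd β x y + matProd β x y' := by
  simp [matProd, mul_add]

theorem matProd_zero (β : Module.Basis (Fin r) F K) (x : Fin r → K) : matProd β x 0 = 0 := by
  simp [matProd]

/-- The matrix of a linear map acts on vectors coordinatewise. -/
theorem matProd_linearMap (β : Module.Basis (Fin r) F K) (L : K →ₗ[F] K) (y : Fin r → K)
    (κ : Fin r) : matProd β (fun i => L (β i)) y κ = L (y κ) := by
  have h : matProd β (fun i => L (β i)) y κ =
      ∑ i, (∑ l, β.repr (L (β l)) i * β.repr (y κ) l) • β i := by
    simp [matProd, matRep, Matrix.mul_apply]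
  have hy : L (y κ) = ∑ l, β.repr (y κ) l • L (β l) := by
    conv_lhs => rw [← β.sum_repr (y κ), map_sum]
    simp
  rw [h, hy, ← β.repr.injective.eq_iff]
  ext i
  simp [Finsupp.single_apply, mul_comm]

/-- Right multiplication by a diagonal matrix scales columns, and columns are the coordinates of the
block. -/
theorem matProd_indicatorBlock (β : Module.Basis (Fin r) F K) {g : ℕ} (h u v : ℕ) (j : Fin g)
    (x : Fin r → K) (κ : Fin r) :
    matProd β x (indicatorBlock β h u v j) κ =
      if place (j, κ) ∈ window h u v then x κ else 0 := by
  have hx : (matRep β).symm (matRep β x) κ = x κ := by rw [LinearEquiv.symm_apply_apply]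
  rw [matProd, indicatorBlock, LinearEquiv.apply_symm_apply]
  split_ifs with hp
  · rw [← hx]
    simp [matRep, Matrix.mul_diagonal, hp]
  · simp [matRep, Matrix.mul_diagonal, hp]

/-- The blockwise product of codewords of dimensions `k` and `l` is a codeword of dimension
`k + l - 1`. -/
theorem matProd_mem_lrsCode [Fintype F] (β : Module.Basis (Fin r) F K) (γ : K) {g k l : ℕ}
    {z d : Fin g × Fin r → K} (hz : z ∈ lrsCode β γ g k) (hd : d ∈ lrsCode β γ g l) :
    (fun p => matProd β (fun κ => z (p.1, κ)) (fun κ => d (p.1, κ)) p.2) ∈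
      lrsCode β γ g (k + l - 1) := by
  obtain ⟨f, rfl⟩ := hz
  obtain ⟨f', rfl⟩ := hd
  have h : (fun p : Fin g × Fin r => matProd β (fun κ => lrsEval β γ g k f (p.1, κ))
      (fun κ => lrsEval β γ g l f' (p.1, κ)) p.2) =
      ∑ i : Fin k, ∑ i' : Fin l, fun p : Fin g × Fin r =>
        (f i * f' i' ^ (Fintype.card F ^ (i : ℕ))) *
          linOp F (γ ^ (p.1 : ℕ)) (i + i') (β p.2) := by
    ext p
    -- Only the left factor is viewed as a linear map; the right one stays a vector to which it is
    -- applied.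
    simp only [lrsEval_eq_skewEval β γ f]
    rw [matProd_linearMap, skewEval_apply, Finset.sum_range]
    simp only [Finset.sum_apply, Fin.is_lt, dite_true, Fin.eta]
    refine Finset.sum_congr rfl fun i _ => ?_
    simp only [lrsEval, LinearMap.coe_mk, AddHom.coe_mk]
    rw [← linOpHom_apply, map_sum, Finset.mul_sum]
    refine Finset.sum_congr rfl fun i' _ => ?_
    rw [linOpHom_apply, linOp_mul_linOp, mul_assoc]
  rw [h]
  exact Submodule.sum_mem _ fun i _ => Submodule.sum_mem _ fun i' _ =>
    linOp_mem_lrsCode β γ _ (by omega)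

end Products

/-! ### Places and windows -/

section Places

variable {g r : ℕ}

theorem place_eq_finProdFinEquiv (p : Fin g × Fin r) : place p = finProdFinEquiv p := by
  simp [place, finProdFinEquiv, mul_comm, add_comm]

theorem card_filter_place_mem (S : Finset ℕ) (hS : ∀ n ∈ S, n < g * r) :
    (Finset.univ.filter fun p : Fin g × Fin r => place p ∈ S).card = S.card := by
  refine Finset.card_bij (fun p _ => place p) (by simp) ?_ ?_
  · intro p _ p' _ h
    rw [place_eq_finProdFinEquiv, place_eq_finProdFinEquiv] at h
    exact finProdFinEquiv.injective (Fin.ext h)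
  · intro n hn
    refine ⟨finProdFinEquiv.symm ⟨n, hS n hn⟩, ?_, ?_⟩
    · simpa only [place_eq_finProdFinEquiv, Equiv.apply_symm_apply, Finset.mem_filter_univ]
    · rw [place_eq_finProdFinEquiv, Equiv.apply_symm_apply]

/-- Windows are the fibres of `n ↦ n / h`, so within one iteration they are disjoint. -/
theorem mem_window_iff {h u v n : ℕ} (hpos : 0 < h) : n ∈ window h u v ↔ n / h = v + u := by
  rw [window, Finset.mem_Ico, Nat.div_eq_iff hpos]
  rw [mul_comm]
  omega

end Places

/-! ### Retrieval of the file -/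

section Retrieval

variable {F : Type*} {K : Type*} [Field F] [Field K] [Algebra F K] {g r δ k m b : ℕ}

/-- Since `A` is systematic, the local code disappears and only the outer codeword is left. -/
theorem nonRedundant_stored (G : Matrix (Fin k) (Fin g × Fin r) K)
    {A : Matrix (Fin r) (Fin (r + (δ - 1))) F}
    (hsys : ∀ i j : Fin r, A i (Fin.castAdd (δ - 1) j) = (1 : Matrix (Fin r) (Fin r) F) i j)
    (X : Fin m → Matrix (Fin b) (Fin k) K) (j : Fin g) (p : Fin m × Fin b) (κ : Fin r) :
    nonRedundant (stored (globalGen (δ := δ) G A) X j) p κ = (X p.1 * G) p.2 (j, κ) := by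
  rw [nonRedundant, stored, globalGen, ← Matrix.mul_assoc, Matrix.mul_apply,
    Fintype.sum_prod_type]
  simp [Matrix.kroneckerMap_apply, hsys, Matrix.one_apply]

theorem mul_generatorMatrix_mem {G : Matrix (Fin k) (Fin g × Fin r) K}
    {C : Submodule K (Fin g × Fin r → K)} (hG : IsGeneratorMatrix G C)
    (X : Matrix (Fin b) (Fin k) K) (v : Fin b) : (X * G) v ∈ C := by
  have : (X * G) v = ∑ i, X v i • G.row i := by
    ext p
    simp [Matrix.mul_apply]
  rw [this, ← hG.2]
  exact Submodule.sum_mem _ fun i _ => Submodule.smul_mem _ _ (Submodule.subset_span ⟨i, rfl⟩)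

/-- The vector that the user reads off from the response of iteration `u`. -/
def windowVector (h u : ℕ) (y : Matrix (Fin b) (Fin g × Fin r) K) : Fin g × Fin r → K :=
  fun p => ∑ v : Fin b, if place p ∈ window h u v then y v p else 0

/-- Distributivity splits the response: the masks contribute codewords, the indicator blocks
contribute the window vector. -/
theorem response_sub_windowVector_mem [Fintype F] (β : Module.Basis (Fin r) F K) (γ : K) {t h : ℕ}
    {y : Fin m → Matrix (Fin b) (Fin g × Fin r) K} (hy : ∀ ℓ v, y ℓ v ∈ lrsCode β γ g k)
    (d : Fin m × Fin b → lrsCode β γ g (r * t)) (i : Fin m) (u : ℕ) :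
    (fun p : Fin g × Fin r => innerMatProd β (fun (a : Fin m × Fin b) κ => y a.1 a.2 (p.1, κ))
      (fun a κ => (d a : Fin g × Fin r → K) (p.1, κ) +
        if a.1 = i then indicatorBlock β h u a.2 p.1 κ else 0) p.2) -
      windowVector h u (y i) ∈ lrsCode β γ g (k + r * t - 1) := by
  have hsum : (fun p : Fin g × Fin r =>
      innerMatProd β (fun (a : Fin m × Fin b) κ => y a.1 a.2 (p.1, κ))
      (fun a κ => (d a : Fin g × Fin r → K) (p.1, κ) +
        if a.1 = i then indicatorBlock β h u a.2 p.1 κ else 0) p.2) - windowVector h u (y i) =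
      ∑ a : Fin m × Fin b, fun p : Fin g × Fin r =>
        matProd β (fun κ => y a.1 a.2 (p.1, κ))
          (fun κ => (d a : Fin g × Fin r → K) (p.1, κ)) p.2 := by
    ext p
    have hblock : ∀ a : Fin m × Fin b, matProd β (fun κ => y a.1 a.2 (p.1, κ))
        (fun κ => (d a : Fin g × Fin r → K) (p.1, κ) +
          if a.1 = i then indicatorBlock β h u a.2 p.1 κ else 0) p.2 =
        matProd β (fun κ => y a.1 a.2 (p.1, κ))
          (fun κ => (d a : Fin g × Fin r → K) (p.1, κ)) p.2 +
        if a.1 = i then (if place p ∈ window h u a.2 then y a.1 a.2 p else 0) else 0 := by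
      intro a
      have h1 := matProd_add β (fun κ => y a.1 a.2 (p.1, κ))
        (fun κ => (d a : Fin g × Fin r → K) (p.1, κ))
        (fun κ => if a.1 = i then indicatorBlock β h u a.2 p.1 κ else 0)
      have h2 := congrFun h1 p.2
      rw [Pi.add_apply] at h2
      refine h2.trans (congrArg _ ?_)
      split_ifs with hi hp
      · simpa [hp] using matProd_indicatorBlock β h u a.2 p.1 (fun κ => y a.1 a.2 (p.1, κ)) p.2
      · simpa [hp] using matProd_indicatorBlock β h u a.2 p.1 (fun κ => y a.1 a.2 (p.1, κ)) p.2
      · exact congrFun (matProd_zero β _) p.2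
    simp only [Pi.sub_apply, innerMatProd, Finset.sum_apply, windowVector, hblock,
      Finset.sum_add_distrib]
    rw [add_sub_assoc, Fintype.sum_prod_type
      (f := fun a : Fin m × Fin b => if a.1 = i then
        (if place p ∈ window h u a.2 then y a.1 a.2 p else 0) else 0), Finset.sum_comm]
    simp
  rw [hsum]
  exact Submodule.sum_mem _ fun a _ => matProd_mem_lrsCode β γ (hy a.1 a.2) (d a).2

theorem windowVector_apply {h u : ℕ} (hpos : 0 < h) (y : Matrix (Fin b) (Fin g × Fin r) K) (v : Fin b)
    {p : Fin g × Fin r} (hp : place p ∈ window h u v) : windowVector h u y p = y v p := by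
  rw [windowVector, Finset.sum_eq_single v]
  · rw [if_pos hp]
  · intro v' _ hv'
    rw [if_neg]
    intro hp'
    rw [mem_window_iff hpos] at hp hp'
    exact hv' (Fin.ext (by omega))
  · simp

theorem windowVector_eq_zero {h u : ℕ} (y : Matrix (Fin b) (Fin g × Fin r) K)
    {p : Fin g × Fin r} (hp : ∀ v : Fin b, place p ∉ window h u v) :
    windowVector h u y p = 0 :=
  Finset.sum_eq_zero fun v _ => if_neg (hp v)

/-- Uniqueness is essential, since the scheme picks its output by `Classical.epsilon`. -/
theorem isReconstruction_iff [Fintype F] [Fintype K] {t c s h : ℕ} (hq : g < Fintype.card F) (hk : 1 ≤ k) (ht : 1 ≤ t)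
    (hkt : k + r * t ≤ g * r) (β : Module.Basis (Fin r) F K) {γ : Kˣ}
    (hγ : ∀ x : Kˣ, x ∈ Subgroup.zpowers γ)
    {G : Matrix (Fin k) (Fin g × Fin r) K} (hG : IsGeneratorMatrix G (lrsCode β (γ : K) g k))
    {H : Matrix (Fin c) (Fin g × Fin r) K}
    (hH : IsParityCheckMatrix H (lrsCode β (γ : K) g (k + r * t - 1)))
    (hc : c = g * r - k - r * t + 1) (hsh : h * s = k) (hbh : h * b = c)
    {ρ : Fin s → Fin g × Fin r → K} {X : Matrix (Fin b) (Fin k) K}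
    (hρ : ∀ u : Fin s,
      ρ u - windowVector h u (X * G) ∈ lrsCode β (γ : K) g (k + r * t - 1))
    (x : Matrix (Fin b) (Fin k) K) : IsReconstruction G H h ρ x ↔ x = X := by
  have hpos : 0 < h := Nat.pos_of_ne_zero fun h0 => by subst h0; omega
  have hr : 0 < r := Nat.pos_of_ne_zero fun h0 => by subst h0; omega
  have hrt : 1 ≤ r * t := Nat.mul_pos hr ht
  constructor
  · rintro ⟨w, hw0, hwH, hwx⟩
    have hw : ∀ u, w u = windowVector h u (X * G) := by
      intro u
      have hmem : w u - windowVector h u (X * G) ∈ lrsCode β (γ : K) g (k + r * t - 1) := by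
        have h1 : w u - ρ u ∈ lrsCode β (γ : K) g (k + r * t - 1) := by
          rw [hH.2, Matrix.mulVec_sub, hwH, sub_self]
        simpa using Submodule.add_mem _ h1 (hρ u)
      -- The windows of iteration `u` fill the interval of `h * b = c` places from `h * u`; the
      -- difference vanishes on at least `N - c = k + rt - 1` places outside it.
      refine sub_eq_zero.1 (eq_zero_of_mem_lrsCode hq β hγ hmem
        (Z := Finset.univ.filter fun p =>
          place p ∈ Finset.range (g * r) \ Finset.Ico (h * u) (h * u + h * b)) ?_ ?_)
      · rw [card_filter_place_mem _ (by simp +contextual)]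
        refine le_trans ?_ (Finset.le_card_sdiff _ _)
        rw [Nat.card_Ico, Finset.card_range]
        omega
      · intro p hp
        have hp' : ∀ v : Fin b, place p ∉ window h u v := by
          intro v hv
          have hvb : h * (v + 1) ≤ h * b := Nat.mul_le_mul_left _ v.2
          rw [window, Finset.mem_Ico, mul_add] at hv
          rw [mul_add] at hvb
          simp only [Finset.mem_filter, Finset.mem_sdiff, Finset.mem_Ico] at hp
          omega
        rw [Pi.sub_apply, hw0 u p hp', windowVector_eq_zero _ hp', sub_zero]
    have hrow : ∀ v, (x - X) v ᵥ* G = 0 := by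
      intro v
      have hmem := mul_generatorMatrix_mem hG (x - X) v
      -- The windows of row `v`, over all iterations, fill the interval of `h * s = k` places from
      -- `h * v`.
      refine eq_zero_of_mem_lrsCode hq β hγ hmem
        (Z := Finset.univ.filter fun p => place p ∈ Finset.Ico (h * v) (h * v + h * s)) ?_ ?_
      · rw [card_filter_place_mem]
        · simp [hsh]
        · intro n hn
          have hvb : h * (v + 1) ≤ h * b := Nat.mul_le_mul_left _ v.2
          rw [mul_add] at hvb
          rw [Finset.mem_Ico] at hn
          omega
      · intro p hp
        simp only [Finset.mem_filter, Finset.mem_Ico, Finset.mem_univ, true_and] at hp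
        have hdiv : place p / h < v + s := by
          rw [Nat.div_lt_iff_lt_mul hpos, mul_comm, mul_add]
          exact hp.2
        have hdiv' : (v : ℕ) ≤ place p / h := by
          rw [Nat.le_div_iff_mul_le hpos, mul_comm]
          exact hp.1
        let u : Fin s := ⟨place p / h - v, by omega⟩
        have hpu : place p ∈ window h u v := by
          rw [mem_window_iff hpos]
          simp only [u]
          omega
        have := hwx u v p hpu
        rw [hw u, windowVector_apply hpos _ v hpu] at this
        change ((x - X) * G) v p = 0
        rw [Matrix.sub_mul, Matrix.sub_apply, this, sub_self]
    refine funext fun v => ?_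
    have hinj := Matrix.vecMul_injective_iff.2 hG.1
    exact sub_eq_zero.1 (hinj ((hrow v).trans (Matrix.zero_vecMul G).symm))
  · rintro rfl
    refine ⟨fun u => windowVector h u (x * G), fun u p hp => windowVector_eq_zero _ hp,
      fun u => ?_, fun u v p hp => (windowVector_apply hpos _ v hp).symm⟩
    have := (hH.2 _).1 (hρ u)
    rw [Matrix.mulVec_sub, sub_eq_zero] at this
    exact this.symm

end Retrieval

/-! ### Privacy -/

section Privacy

/-- If the law of the query is the same for all indices, the joint law is a product; each summand
then has a zero weight or the logarithm of `1`. -/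
theorem mutualInfo_prodLaw_eq_zero {Ω α α' : Type*} [Fintype α] [Fintype α'] (P : PMF Ω)
    (π : PMF α') (q : α' → Ω → α) (hq : ∀ i i', P.map (q i) = P.map (q i')) :
    mutualInfo (prodLaw π P) (fun x => q x.1 x.2) (fun x => x.1) = 0 := by
  classical
  obtain ⟨i₀, -⟩ := π.support_nonempty
  have hY : (prodLaw π P).map (fun x => x.1) = π := by
    rw [prodLaw, PMF.map_bind]
    simp only [PMF.map_comp]
    exact (congrArg π.bind (funext fun a => PMF.map_const P a)).trans π.bind_pure
  have hX : (prodLaw π P).map (fun x => q x.1 x.2) = P.map (q i₀) := by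
    rw [prodLaw, PMF.map_bind]
    simp only [PMF.map_comp]
    refine (congrArg π.bind (funext fun a => ?_)).trans (PMF.bind_const π (P.map (q i₀)))
    exact hq a i₀
  have hXY : ∀ x y, (prodLaw π P).map (fun x => (q x.1 x.2, x.1)) (x, y) =
      P.map (q i₀) x * π y := by
    intro x y
    rw [prodLaw, PMF.map_bind]
    simp only [PMF.map_comp]
    rw [PMF.bind_apply, tsum_eq_single y]
    · rw [mul_comm, ← hq y i₀]
      congr 1
      simp [PMF.map_apply]
    · intro a ha
      simp [PMF.map_apply, ha.symm]
  rw [mutualInfo]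
  refine Finset.sum_eq_zero fun x _ => Finset.sum_eq_zero fun y _ => ?_
  rw [hXY, hX, hY, ENNReal.toReal_mul]
  set z := ((P.map (q i₀)) x).toReal * (π y).toReal
  by_cases hz : z = 0
  · rw [hz, zero_mul]
  · rw [div_self hz, Real.log_one, mul_zero]

theorem map_equiv_uniformOfFintype {α : Type*} [Fintype α] [Nonempty α] (e : α ≃ α) :
    (PMF.uniformOfFintype α).map e = PMF.uniformOfFintype α := by
  classical
  ext a
  rw [PMF.map_apply, tsum_eq_single (e.symm a)]
  · simp
  · intro x hx
    rw [if_neg]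
    rintro rfl
    simp at hx

/-- One translation `e` works for all iterations at once, which gives joint privacy as well. -/
theorem exists_query_translate {F : Type*} {K : Type*} [Field F] [Field K] [Algebra F K]
    {g r k c : ℕ} [Fintype F] [Fintype K] (hq : g < Fintype.card F) (β : Module.Basis (Fin r) F K)
    {γ : Kˣ} (hγ : ∀ x : Kˣ, x ∈ Subgroup.zpowers γ) {m t b s h : ℕ}
    (G : Matrix (Fin k) (Fin g × Fin r) K) (H : Matrix (Fin c) (Fin g × Fin r) K)
    {T : Finset (Fin g)} (hT : T.card = t) (i i' : Fin m) :
    ∃ e : (lrsScheme β (γ : K) m t b s h G H).Rand ≃ (lrsScheme β (γ : K) m t b s h G H).Rand,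
      (lrsScheme β (γ : K) m t b s h G H).law.map e = (lrsScheme β (γ : K) m t b s h G H).law ∧
      ∀ u ω, ∀ j ∈ T, (lrsScheme β (γ : K) m t b s h G H).query i u ω j =
        (lrsScheme β (γ : K) m t b s h G H).query i' u (e ω) j := by
  subst hT
  -- On the blocks of `T` the codeword equals the indicator part for `i` minus that for `i'`.
  choose x hx hxT using fun (u : Fin s) (p : Fin m × Fin b) =>
    exists_mem_lrsCode_eq_on hq β hγ T fun a =>
      (if p.1 = i then indicatorBlock β h u p.2 a.1 a.2 else 0) -
        if p.1 = i' then indicatorBlock β h u p.2 a.1 a.2 else 0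
  let d₀ : Fin s → Fin m × Fin b → lrsCode β (γ : K) g (r * T.card) := fun u p => ⟨x u p, hx u p⟩
  let e : (Fin s → Fin m × Fin b → lrsCode β (γ : K) g (r * T.card)) ≃ _ := Equiv.addRight d₀
  refine ⟨e, @map_equiv_uniformOfFintype _ (Fintype.ofFinite _) _ e, ?_⟩
  intro u ω j hj
  ext p κ
  change (ω u p : Fin g × Fin r → K) (j, κ) + _ =
    ((ω u p : Fin g × Fin r → K) (j, κ) + x u p (j, κ)) + _
  rw [hxT u p j hj κ]
  ring

end Privacy

/-! ### Window size -/

section Parameters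

/-- In the folded scheme `h` is `gcd c k`; in the first scheme it is `c`. -/
theorem window_parameters {k c b s h : ℕ} (hk : 1 ≤ k) (hc : 1 ≤ c)
    (hbs : (b = 1 ∧ k = s * c) ∨ (b = Nat.lcm c k / k ∧ s = Nat.lcm c k / c))
    (hh : h = k / s) : h * s = k ∧ h * b = c := by
  rcases hbs with ⟨rfl, rfl⟩ | ⟨hb, hs⟩
  · have hs : 0 < s := Nat.pos_of_mul_pos_right hk
    rw [Nat.mul_div_cancel_left _ hs] at hh
    subst hh
    exact ⟨mul_comm _ _, mul_one _⟩
  · have hsc : s * c = Nat.lcm c k := by rw [hs, Nat.div_mul_cancel (Nat.dvd_lcm_left c k)]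
    have hbk : b * k = Nat.lcm c k := by rw [hb, Nat.div_mul_cancel (Nat.dvd_lcm_right c k)]
    have hgl := Nat.gcd_mul_lcm c k
    have h1 : Nat.gcd c k * s = k := by
      refine Nat.eq_of_mul_eq_mul_right hc ?_
      rw [mul_assoc, hsc, hgl, mul_comm]
    have h2 : Nat.gcd c k * b = c := by
      refine Nat.eq_of_mul_eq_mul_right hk ?_
      rw [mul_assoc, hbk, hgl]
    have hspos : 0 < s := Nat.pos_of_ne_zero fun h0 => by subst h0; omega
    have h3 : h = Nat.gcd c k := by
      rw [hh]
      exact Nat.div_eq_of_eq_mul_left hspos h1.symm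
    exact ⟨h3 ▸ h1, h3 ▸ h2⟩

end Parameters

end LRSPIR


/-! ### Assembly -/

open LRSPIR
theorem mainTheorem3 {F K : Type*} [Field F] [Fintype F] [Field K] [Fintype K] [Algebra F K]
    -- parameters: `q = |F|`, `N = g r`, files, colluding servers
    {g r δ k m t : ℕ} (hq : g < Fintype.card F) (hδ : 1 ≤ δ) (hk : 1 ≤ k) (ht : 1 ≤ t)
    (hkt : k + r * t ≤ g * r)
    -- the ordered basis and the primitive element
    (β : Module.Basis (Fin r) F K) (γ : Kˣ) (hγ : ∀ x : Kˣ, x ∈ Subgroup.zpowers γ)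
    -- the outer code is a linearized Reed-Solomon code
    (Gout : Matrix (Fin k) (Fin g × Fin r) K)
    (hGout : IsGeneratorMatrix Gout (lrsCode β (γ : K) g k))
    -- the local code is MDS, with a systematic generator matrix
    (Cloc : Submodule F (Fin (r + (δ - 1)) → F)) (hCloc : IsMDS Cloc r)
    (A : Matrix (Fin r) (Fin (r + (δ - 1))) F) (hA : IsGeneratorMatrix A Cloc)
    (hsys : ∀ i j : Fin r, A i (Fin.castAdd (δ - 1) j) = (1 : Matrix (Fin r) (Fin r) F) i j)
    -- `c = N - k - r t + 1`, and the parameters of the first scheme or of the second scheme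
    (c b s h : ℕ) (hc : c = g * r - k - r * t + 1)
    (hbs : (b = 1 ∧ k = s * c) ∨ (b = Nat.lcm c k / k ∧ s = Nat.lcm c k / c))
    (hh : h = k / s) :
    (∃ H : Matrix (Fin c) (Fin g × Fin r) K,
      IsParityCheckMatrix H (lrsCode β (γ : K) g (k + r * t - 1))) ∧
    ∀ H : Matrix (Fin c) (Fin g × Fin r) K,
      IsParityCheckMatrix H (lrsCode β (γ : K) g (k + r * t - 1)) →
      (lrsScheme β (γ : K) m t b s h Gout H).RetrievesFrom β (globalGen (δ := δ) Gout A) ∧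
      (lrsScheme β (γ : K) m t b s h Gout H).rate =
        ((g * r : ℕ) - (k : ℚ) - r * t + 1) / (g * r : ℕ) ∧
      (lrsScheme β (γ : K) m t b s h Gout H).ProtectsAgainst t ∧
      (lrsScheme β (γ : K) m t b s h Gout H).ProtectsJointlyAgainst t := by
  have hr : 0 < r := Nat.pos_of_ne_zero fun h0 => by subst h0; omega
  have hrt : 1 ≤ r * t := Nat.mul_pos hr ht
  obtain ⟨hsh, hbh⟩ := window_parameters hk (by omega) hbs hh
  refine ⟨exists_isParityCheckMatrix _ ?_, fun H hH => ⟨?_, ?_, ?_, ?_⟩⟩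
  · rw [finrank_lrsCode hq β hγ (by omega)]
    simp only [Fintype.card_prod, Fintype.card_fin]
    omega
  · intro X i ω
    have hy : ∀ ℓ v, (X ℓ * Gout) v ∈ lrsCode β (γ : K) g k := fun ℓ v =>
      mul_generatorMatrix_mem hGout (X ℓ) v
    have hρ : ∀ u : Fin s, (lrsScheme β (γ : K) m t b s h Gout H).responses β
        (fun j => nonRedundant (stored (globalGen (δ := δ) Gout A) X j)) i ω u -
          windowVector h u (X i * Gout) ∈ lrsCode β (γ : K) g (k + r * t - 1) := by
      intro u
      have hz : (fun j => nonRedundant (stored (globalGen (δ := δ) Gout A) X j)) =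
          fun j a κ => (X a.1 * Gout) a.2 (j, κ) := by
        ext j a κ
        exact nonRedundant_stored Gout hsys X j a κ
      rw [hz]
      exact response_sub_windowVector_mem β (γ : K) hy (ω u) i u
    have hiff := isReconstruction_iff hq hk ht hkt β hγ hGout hH hc hsh hbh hρ
    exact (hiff _).1 (Classical.epsilon_spec ⟨X i, (hiff _).2 rfl⟩)
  · have hs : 0 < s := Nat.pos_of_ne_zero fun h0 => by subst h0; omega
    have hcN : (c : ℚ) = (g * r : ℕ) - (k : ℚ) - r * t + 1 := by
      have : c + (k + r * t) = g * r + 1 := by omega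
      have h' : (c : ℚ) + (k + r * t) = (g * r : ℕ) + 1 := by exact_mod_cast this
      linear_combination h'
    have hbk : b * k = c * s := by rw [← hbh, ← hsh]; ring
    rw [← hcN, PIRScheme.rate, hbk]
    change ((c * s : ℕ) : ℚ) / ((g * r * s : ℕ) : ℚ) = _
    rw [Nat.cast_mul, Nat.cast_mul (g * r)]
    exact mul_div_mul_right _ _ (by exact_mod_cast hs.ne')
  · intro T hT u π
    refine mutualInfo_prodLaw_eq_zero _ π (fun i ω => fun j : {j // j ∈ T} =>
      (lrsScheme β (γ : K) m t b s h Gout H).query i u ω j.1) fun i i' => ?_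
    obtain ⟨e, he, hqe⟩ := exists_query_translate (b := b) (s := s) (h := h) hq β hγ Gout H hT i i'
    conv_rhs => rw [← he, PMF.map_comp]
    exact congrArg (PMF.map · _) (funext fun ω => funext fun j => hqe u ω j.1 j.2)
  · intro T hT π
    refine mutualInfo_prodLaw_eq_zero _ π (fun i ω => fun u (j : {j // j ∈ T}) =>
      (lrsScheme β (γ : K) m t b s h Gout H).query i u ω j.1) fun i i' => ?_
    obtain ⟨e, he, hqe⟩ := exists_query_translate (b := b) (s := s) (h := h) hq β hγ Gout H hT i i'
    conv_rhs => rw [← he, PMF.map_comp]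
    exact congrArg (PMF.map · _)
      (funext fun ω => funext fun u => funext fun j => hqe u ω j.1 j.2)
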